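/- Let $P$ be a pregroup in the sense of Stallings: a set with a distinguished element $\varepsilon$, an involution $a\mapsto\bar a$ and a partial multiplication $(a,b)\mapsto[ab]$, defined for $(a,b)$ in some $D\subseteq P\times P$ (we then say that $ab$ is defined), such that for all $a,b,c,d\in P$: (P1) $a\varepsilon$ and $\varepsilon a$ are defined and equal $a$; (P2) $a\bar a$ and $\bar a a$ are defined and equal $\varepsilon$; (P3) if $ab$ is defined, then so is $\bar b\,\bar a$, and $\overline{[ab]}=[\bar b\,\bar a]$; (P4) if $ab$ and $bc$ are defined, then $[ab]c$ is defined if and only if $a[bc]$ is defined, in which case they are equal; (P5) if $ab$, $bc$ and $cd$ are defined, then $a[bc]$ or $b[cd]$ is defined. Let $\Gamma=P\setminus\{\varepsilon\}$ and let $U(P)$ be the universal group of $P$, that is, the quotient of the free monoid $\Gamma^*$ by the relations, for $a,b\in\Gamma$: $ab=1$ if $ab$ is defined and $[ab]=\varepsilon$; $ab=[ab]$ if $ab$ is defined and $[ab]\neq\varepsilon$; and $ab=[ac][\bar c b]$ if $c\in P$, $ac$ and $\bar c b$ are defined, and $ab$ is not defined (in which case $[ac],[\bar cb]\in\Gamma$).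 A word $w\in\Gamma^*$ is called cyclically reduced if it is a shortest word among all words over $\Gamma$ that represent an element of the conjugacy class of $w$ in $U(P)$. **Theorem.** Let $g=g_1\cdots g_n$ and $f$ be cyclically reduced words over $\Gamma$, where $g_1,\dots,g_n\in\Gamma$ and $n\ge 2$, and suppose that $g$ and $f$ are conjugate in $U(P)$. Then $f$ is obtained, as an element of $U(P)$, from $g$ by a single cyclic permutation followed by a single preconjugation: there are an index $i\in\{1,\dots,n\}$ and an element $b\in P$ such that $bg_i$ and $g_{i-1}\bar b$ are defined (with $g_0=g_n$), $[bg_i]$ and $[g_{i-1}\bar b]$ lie in $\Gamma$, and $$f=[bg_i]\,g_{i+1}\cdots g_n\,g_1\cdots g_{i-2}\,[g_{i-1}\bar b]\quad\text{in }U(P),$$ where the right-hand side has first letter $[bg_i]$, last letter $[g_{i-1}\bar b]$, and between them the remaining $n-2$ letters of $g$ in cyclic order. -/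

import Mathlib

/-- A pregroup in the sense of Stallings. The partial multiplication is a function to `Option P`:
`mul a b = some c` says that `ab` is defined (that is, `(a, b) ∈ D`) and `[ab] = c`;
`mul a b = none` says that `ab` is not defined. -/
class Pregroup (P : Type*) where
  /-- the distinguished element `ε` -/
  eps : P
  /-- the involution `a ↦ ā` -/
  inv : P → P
  /-- the partial multiplication -/
  mul : P → P → Option P
  inv_inv : ∀ a, inv (inv a) = a
  /-- (P1) -/
  mul_eps : ∀ a, mul a eps = some a
  eps_mul : ∀ a, mul eps a = some a
  /-- (P2) -/
  inv_mul : ∀ a, mul (inv a) a = some eps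
  mul_inv : ∀ a, mul a (inv a) = some eps
  /-- (P3) -/
  mul_rev : ∀ a b x, mul a b = some x → mul (inv b) (inv a) = some (inv x)
  /-- (P4): if `ab = x` and `bc = y` are defined, then `xc` is defined if and only if `ay` is,
  and in that case they are equal; that is, `xc` and `ay` agree as elements of `Option P`. -/
  mul_assoc : ∀ a b c x y, mul a b = some x → mul b c = some y → mul x c = mul a y
  /-- (P5): if `ab`, `bc = y` and `cd = z` are defined, then `ay` or `bz` is defined. -/
  mul_five : ∀ a b c d x y z, mul a b = some x → mul b c = some y → mul c d = some z →
    (∃ u, mul a y = some u) ∨ (∃ v, mul b z = some v)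

namespace Pregroup

/-- The alphabet `Γ = P \ {ε}`. -/
abbrev Letter (P : Type*) [Pregroup P] : Type _ := {a : P // a ≠ (eps : P)}

/-- The Thue system `S(P)` over `Γ`. -/
inductive Rule (P : Type*) [Pregroup P] : FreeMonoid (Letter P) → FreeMonoid (Letter P) → Prop
  /-- `ab → 1` if `[ab] = ε` -/
  | cancel (a b : Letter P) (h : mul a.1 b.1 = some eps) :
      Rule P (FreeMonoid.of a * FreeMonoid.of b) 1
  /-- `ab → [ab]` if `ab` is defined and `[ab] ≠ ε` -/
  | contract (a b x : Letter P) (h : mul a.1 b.1 = some x.1) :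
      Rule P (FreeMonoid.of a * FreeMonoid.of b) (FreeMonoid.of x)
  /-- `ab ↔ [ac][c̄b]` if `ac` and `c̄b` are defined and `ab` is not -/
  | interchange (a b x y : Letter P) (c : P) (hab : mul a.1 b.1 = none)
      (hx : mul a.1 c = some x.1) (hy : mul (inv c) b.1 = some y.1) :
      Rule P (FreeMonoid.of a * FreeMonoid.of b) (FreeMonoid.of x * FreeMonoid.of y)

/-- The universal group `U(P) = Γ* / {ℓ = r | (ℓ, r) ∈ S(P)}`, as a quotient of the free monoid by
the congruence generated by `S(P)`. -/
abbrev U (P : Type*) [Pregroup P] : Type _ := (conGen (Rule P)).Quotient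

/-- The element of `U(P)` represented by a word `w ∈ Γ*`. -/
def toU {P : Type*} [Pregroup P] (w : List (Letter P)) : U P :=
  (conGen (Rule P)).mk' (FreeMonoid.ofList w)

theorem inv_eps {P : Type*} [Pregroup P] : inv (eps : P) = eps := by
  have h := inv_mul (eps : P)
  rw [mul_eps] at h
  exact Option.some.inj h

/-- The involution restricted to `Γ`. -/
def Letter.inv {P : Type*} [Pregroup P] (a : Letter P) : Letter P :=
  ⟨Pregroup.inv a.1, fun h => a.2 (by rw [← inv_inv a.1, h, inv_eps])⟩

theorem isUnit_U {P : Type*} [Pregroup P] (z : U P) : IsUnit z := by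
  induction z using Con.induction_on with
  | H w =>
    induction w using FreeMonoid.inductionOn' with
    | one => exact isUnit_one
    | of_mul a w ih =>
      have ha : IsUnit (((FreeMonoid.of a : FreeMonoid (Letter P)) : U P)) :=
        ⟨⟨((FreeMonoid.of a : FreeMonoid (Letter P)) : U P),
          ((FreeMonoid.of a.inv : FreeMonoid (Letter P)) : U P),
          (Con.eq _).2 (ConGen.Rel.of _ _ (Rule.cancel a a.inv (mul_inv a.1))),
          (Con.eq _).2 (ConGen.Rel.of _ _ (Rule.cancel a.inv a (inv_mul a.1)))⟩, rfl⟩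
      exact ha.mul ih

/-- `U(P)` is a group; its multiplication is that of the quotient monoid. -/
noncomputable instance instGroupU {P : Type*} [Pregroup P] : Group (U P) := groupOfIsUnit isUnit_U

/-- A word over `Γ` is cyclically reduced if its cyclic word is geodesic, i.e. if it is a shortest
word among all words over `Γ` that represent an element of its conjugacy class in `U(P)`. -/
def CyclicallyReduced {P : Type*} [Pregroup P] (w : List (Letter P)) : Prop :=
  ∀ u : List (Letter P), IsConj (toU u) (toU w) → w.length ≤ u.length

/-- For a word `u = a₁ ⋯ aₙ` with `n ≥ 2` and `b ∈ P`: `b a₁` and `aₙ b̄` are defined, and `v` is the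
word `[b a₁] a₂ ⋯ aₙ₋₁ [aₙ b̄]`, i.e. `v` is the preconjugation of `u` by `b̄`. -/
def IsPreconjugation {P : Type*} [Pregroup P] (b : P) (u v : List (Letter P)) : Prop :=
  ∃ (a z x y : Letter P) (m : List (Letter P)),
    u = a :: (m ++ [z]) ∧ mul b a.1 = some x.1 ∧ mul z.1 (inv b) = some y.1 ∧
      v = x :: (m ++ [y])

end Pregroup

namespace Pregroup

variable {P : Type*} [Pregroup P]

/-! The proof rests on two facts.

First, reduced words of length at least 2 are geodesic in `U P` (`length_le_of_toU_eq`). Contraction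
is confluent modulo interchange (`Contract.diamond`, `Swap.contract`), so all reduced words reached
from equivalent words have one length. Words over `P` get a leading ε, so that contraction never has
to produce the empty word.

Second, between letters with undefined products, an element is absorbed by at most two of them
(`mul_eq_none_of_absorb_left`, its mirror); this is (P5).

Let `h` be a shortest word conjugating some rotation `w` of `g` to `f`. Rotate until the last letter
of `h` is not absorbed on the left of `w`; on the right at most two letters absorb. This yields a
reduced word for `f` of length at least `2|h| + n - 2`, which exceeds `n ≥ |f|` if `|h| ≥ 2`. So `h`
is at most one letter `b`. If `b` is not absorbed on both sides, either one more rotation achieves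
this or `f` equals a reduced word longer than `n`. -/

/-! ### Cancellation and absorption in a pregroup -/

theorem mul_inv_cancel_right {a b x : P} (h : mul a b = some x) : mul x (inv b) = some a := by
  rw [mul_assoc a b (inv b) x eps h (mul_inv b), mul_eps]

theorem inv_mul_cancel_left {a b x : P} (h : mul a b = some x) : mul (inv a) x = some b := by
  rw [← mul_assoc (inv a) a b eps x (inv_mul a) h, eps_mul]

theorem mul_inv_mul_cancel_left {c b y : P} (h : mul (inv c) b = some y) : mul c y = some b := by
  have := inv_mul_cancel_left h
  rwa [inv_inv] at this

/-- Between three letters without defined products, an element multiplied from the right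
is absorbed by at most two of them. -/
theorem mul_eq_none_of_absorb_left {a b c x y z : P} (hab : mul a b = none) (hbc : mul b c = none)
    (hy : mul c x = some y) (hz : mul b y = some z) : mul a z = none := by
  by_contra hne
  obtain ⟨t, ht⟩ := Option.ne_none_iff_exists'.1 hne
  have h1 : mul z (inv y) = some b := mul_inv_cancel_right hz
  have h2 : mul (inv y) c = some (inv x) := by
    have h := mul_rev _ _ _ hy
    have := mul_inv_cancel_right h
    rwa [inv_inv] at this
  -- (P5) for `a, z, ȳ, c`: its two outcomes would make `ab` or `bc` defined.
  rcases mul_five _ _ _ _ _ _ _ ht h1 h2 with ⟨u, hu⟩ | ⟨v, hv⟩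
  · simp [hab] at hu
  · rw [← mul_assoc _ _ _ _ _ h1 h2, hbc] at hv
    simp at hv

theorem mul_inv_inv_eq_none {a b : P} (h : mul a b = none) : mul (inv b) (inv a) = none := by
  by_contra hne
  obtain ⟨t, ht⟩ := Option.ne_none_iff_exists'.1 hne
  have := mul_rev _ _ _ ht
  rw [inv_inv, inv_inv, h] at this
  simp at this

/-- The mirror image of `mul_eq_none_of_absorb_left`. -/
theorem mul_eq_none_of_absorb_right {a b c x y z : P} (hab : mul a b = none)
    (hbc : mul b c = none) (hy : mul x a = some y) (hz : mul y b = some z) : mul z c = none := by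
  have := mul_inv_inv_eq_none (mul_eq_none_of_absorb_left (mul_inv_inv_eq_none hbc)
    (mul_inv_inv_eq_none hab) (mul_rev _ _ _ hy) (mul_rev _ _ _ hz))
  rwa [inv_inv, inv_inv] at this

/-! ### Words over `P` and confluence modulo interchange -/

/-- Replacing two adjacent letters by their product. -/
inductive Contract : List P → List P → Prop
  | head (a b x : P) (q : List P) (h : mul a b = some x) : Contract (a :: b :: q) (x :: q)
  | cons (p : P) (u v : List P) (h : Contract u v) : Contract (p :: u) (p :: v)

/-- Replacing two adjacent letters `a b` by `[ac] [c̄b]`. -/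
inductive Swap : List P → List P → Prop
  | head (a b c x y : P) (q : List P) (hx : mul a c = some x) (hy : mul (inv c) b = some y) :
      Swap (a :: b :: q) (x :: y :: q)
  | cons (p : P) (u v : List P) (h : Swap u v) : Swap (p :: u) (p :: v)

theorem Contract.length_eq {u v : List P} (h : Contract u v) : u.length = v.length + 1 := by
  induction h with
  | head => simp
  | cons p u v h ih => simp [ih]

theorem Swap.length_eq {u v : List P} (h : Swap u v) : u.length = v.length := by
  induction h with
  | head => simp
  | cons p u v h ih => simp [ih]

theorem Swap.symm {u v : List P} (h : Swap u v) : Swap v u := by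
  induction h with
  | head a b c x y q hx hy =>
    refine .head x y (inv c) a b q (mul_inv_cancel_right hx) ?_
    rw [inv_inv]
    exact mul_inv_mul_cancel_left hy
  | cons p u v h ih => exact .cons p _ _ ih

theorem Contract.append {u v : List P} (h : Contract u v) (p q : List P) :
    Contract (p ++ u ++ q) (p ++ v ++ q) := by
  induction p with
  | nil =>
    induction h with
    | head a b x r h => exact .head a b x _ h
    | cons p u v h ih => exact .cons p _ _ ih
  | cons a p ih => exact .cons a _ _ ih

theorem Swap.append {u v : List P} (h : Swap u v) (p q : List P) :
    Swap (p ++ u ++ q) (p ++ v ++ q) := by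
  induction p with
  | nil =>
    induction h with
    | head a b c x y r hx hy => exact .head a b c x y _ hx hy
    | cons p u v h ih => exact .cons p _ _ ih
  | cons a p ih => exact .cons a _ _ ih

/-- The only critical overlap is `abc`: the results `[ab]c` and `a[bc]` differ by the interchange
along `b`. -/
theorem Contract.diamond {u v w : List P} (hv : Contract u v) (hw : Contract u w) :
    v = w ∨ Swap v w ∨ ∃ t, Contract v t ∧ Contract w t := by
  induction hv generalizing w with
  | head a b x q h =>
    cases hw with
    | head _ _ y _ h' =>
      rw [h] at h'
      cases h'
      exact .inl rfl
    | cons _ _ v h' =>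
      cases h' with
      | head _ c y r hy =>
        refine .inr (.inl (.head x c (inv b) a y r (mul_inv_cancel_right h) ?_))
        rwa [inv_inv]
      | cons _ _ v h' => exact .inr (.inr ⟨x :: v, .cons _ _ _ h', .head _ _ _ _ h⟩)
  | cons p u v h ih =>
    cases hw with
    | head _ b x q hx =>
      cases h with
      | head _ c y r hy =>
        exact .inr (.inl (.head p y b x c r hx (inv_mul_cancel_left hy)))
      | cons _ _ v h' => exact .inr (.inr ⟨x :: v, .head _ _ _ _ hx, .cons _ _ _ h'⟩)
    | cons _ _ w h' =>
      rcases ih h' with rfl | h | ⟨t, h1, h2⟩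
      · exact .inl rfl
      · exact .inr (.inl (.cons _ _ _ h))
      · exact .inr (.inr ⟨p :: t, .cons _ _ _ h1, .cons _ _ _ h2⟩)

/-- A contraction overlapping one letter of the swapped pair survives the swap by (P5), at one of
two places. -/
theorem Swap.contract {u v w : List P} (hv : Swap u v) (hw : Contract u w) :
    ∃ t, Contract v t ∧ (w = t ∨ Swap w t) := by
  induction hv generalizing w with
  | head a b c x y q hx hy =>
    have hxc := mul_inv_cancel_right hx
    have hcy := mul_inv_mul_cancel_left hy
    have hxy : mul x y = mul a b := mul_assoc _ _ _ _ _ hx hcy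
    cases hw with
    | head _ _ e _ h => exact ⟨e :: q, .head _ _ _ _ (hxy.trans h), .inl rfl⟩
    | cons _ _ w h =>
      cases h with
      | head _ d e q he =>
        -- (P5) for `x, c̄, b, d`.
        rcases mul_five _ _ _ _ _ _ _ hxc hy he with ⟨t, ht⟩ | ⟨s, hs⟩
        · exact ⟨t :: d :: q, .head _ _ _ _ ht,
            .inr (.head a e b t d q (hxy ▸ ht) (inv_mul_cancel_left he))⟩
        · exact ⟨x :: s :: q, .cons _ _ _ (.head _ _ _ _ ((mul_assoc _ _ _ _ _ hy he).trans hs)),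
            .inr (.head a e c x s q hx hs)⟩
      | cons _ _ w h =>
        exact ⟨x :: y :: w, .cons _ _ _ (.cons _ _ _ h), .inr (.head a b c x y w hx hy)⟩
  | cons p u v h ih =>
    cases hw with
    | head _ a t u ht =>
      cases h with
      | head _ b c x y q hx hy =>
        have hcy := mul_inv_mul_cancel_left hy
        rcases mul_five _ _ _ _ _ _ _ ht hx hcy with ⟨s, hs⟩ | ⟨s, hs⟩
        · refine ⟨s :: y :: q, .head _ _ _ _ hs, .inr (.head t b c s y q ?_ hy)⟩
          rw [mul_assoc _ _ _ _ _ ht hx, hs]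
        · refine ⟨p :: s :: q, .cons _ _ _ (.head _ _ _ _ ?_),
            .inr (.head t b (inv a) p s q (mul_inv_cancel_right ht) ?_)⟩
          · rw [mul_assoc _ _ _ _ _ hx hcy, hs]
          · rwa [inv_inv]
      | cons _ _ v h => exact ⟨t :: v, .head _ _ _ _ ht, .inr (.cons _ _ _ h)⟩
    | cons _ _ w h' =>
      obtain ⟨t, h1, h2⟩ := ih h'
      refine ⟨p :: t, .cons _ _ _ h1, ?_⟩
      rcases h2 with rfl | h2
      · exact .inl rfl
      · exact .inr (.cons _ _ _ h2)

/-! ### Reduced words and the uniqueness of their length -/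

/-- A word that contains no two adjacent letters whose product is defined. -/
def Reduced (w : List P) : Prop := w.IsChain fun a b => mul a b = none

theorem Reduced.not_contract {u v : List P} (hu : Reduced u) : ¬ Contract u v := by
  intro h
  unfold Reduced at hu
  induction h with
  | head a b x q h => simp [h] at hu
  | cons p u v h ih => exact ih hu.of_cons

theorem reduced_or_exists_contract (u : List P) : Reduced u ∨ ∃ v, Contract u v := by
  unfold Reduced
  induction u with
  | nil => exact .inl (by simp)
  | cons a u ih =>
    rcases ih with h | ⟨v, h⟩
    · cases u with
      | nil => exact .inl (by simp)
      | cons b u =>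
        cases hab : mul a b with
        | none => exact .inl (List.isChain_cons_cons.2 ⟨hab, h⟩)
        | some x => exact .inr ⟨_, .head _ _ _ _ hab⟩
    · exact .inr ⟨_, .cons _ _ _ h⟩

/-- `u` contracts to a reduced word of length `k`. -/
inductive ReducesToLength : List P → ℕ → Prop
  | refl (u : List P) (h : Reduced u) : ReducesToLength u u.length
  | step (u v : List P) (k : ℕ) (h : Contract u v) (hv : ReducesToLength v k) :
      ReducesToLength u k

theorem exists_reducesToLength (u : List P) : ∃ k, ReducesToLength u k := by
  induction h : u.length generalizing u with
  | zero =>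
    rcases reduced_or_exists_contract u with hu | ⟨v, hv⟩
    · exact ⟨_, .refl u hu⟩
    · have := hv.length_eq
      omega
  | succ n ih =>
    rcases reduced_or_exists_contract u with hu | ⟨v, hv⟩
    · exact ⟨_, .refl u hu⟩
    · obtain ⟨k, hk⟩ := ih v (by have := hv.length_eq; omega)
      exact ⟨k, .step _ _ _ hv hk⟩

theorem ReducesToLength.eq_length {u : List P} {k : ℕ} (h : ReducesToLength u k)
    (hu : Reduced u) : k = u.length := by
  cases h with
  | refl => rfl
  | step _ v _ h _ => exact absurd h hu.not_contract

theorem ReducesToLength.bounds {u : List P} {k : ℕ} (h : ReducesToLength u k) (hu : u ≠ []) :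
    k ≤ u.length := by
  induction h with
  | refl => rfl
  | step u v k h hv ih =>
    have := h.length_eq
    have := ih (by cases h <;> simp)
    omega

/-- Both claims are needed together: two contractions of one word may differ by a swap, and swapped
words are compared through contractions, which are shorter. -/
theorem reducesToLength_unique (n : ℕ) : ∀ u : List P, u.length = n →
    (∀ j k, ReducesToLength u j → ReducesToLength u k → j = k) ∧
    ∀ v, Swap u v → ∀ j k, ReducesToLength u j → ReducesToLength v k → j = k := by
  induction n with
  | zero =>
    intro u hu
    obtain rfl := List.length_eq_zero_iff.1 hu
    have h0 : Reduced ([] : List P) := List.isChain_nil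
    refine ⟨fun j k hj hk => (hj.eq_length h0).trans (hk.eq_length h0).symm, fun v h => ?_⟩
    cases h
  | succ n ih =>
    have hA : ∀ u : List P, u.length = n + 1 →
        ∀ j k, ReducesToLength u j → ReducesToLength u k → j = k := by
      intro u hu j k hj hk
      cases hj with
      | refl _ h => exact (hk.eq_length h).symm
      | step _ v _ hv hvj =>
        cases hk with
        | refl _ h => exact absurd hv h.not_contract
        | step _ w _ hw hwk =>
          have lv := hv.length_eq
          have lw := hw.length_eq
          rcases hv.diamond hw with rfl | h | ⟨t, h1, h2⟩
          · exact (ih v (by omega)).1 _ _ hvj hwk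
          · exact (ih v (by omega)).2 _ h _ _ hvj hwk
          · obtain ⟨l, hl⟩ := exists_reducesToLength t
            exact ((ih v (by omega)).1 _ _ hvj (.step _ _ _ h1 hl)).trans
              ((ih w (by omega)).1 _ _ hwk (.step _ _ _ h2 hl)).symm
    have hB : ∀ u v w : List P, u.length = n + 1 → Swap u v → Contract u w →
        ∀ j k, ReducesToLength u j → ReducesToLength v k → j = k := by
      intro u v w hu h hw j k hj hk
      obtain ⟨t, ht, hwt⟩ := h.contract hw
      have lw := hw.length_eq
      obtain ⟨l, hl⟩ := exists_reducesToLength w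
      obtain ⟨l', hl'⟩ := exists_reducesToLength t
      have e1 := hA u hu _ _ hj (.step _ _ _ hw hl)
      have e2 := hA v (h.length_eq ▸ hu) _ _ hk (.step _ _ _ ht hl')
      have e3 : l = l' := by
        rcases hwt with rfl | hwt
        · exact (ih w (by omega)).1 _ _ hl hl'
        · exact (ih w (by omega)).2 _ hwt _ _ hl hl'
      omega
    intro u hu
    refine ⟨hA u hu, fun v h j k hj hk => ?_⟩
    rcases reduced_or_exists_contract u with hru | ⟨w, hw⟩
    · rcases reduced_or_exists_contract v with hrv | ⟨w, hw⟩
      · rw [hj.eq_length hru, hk.eq_length hrv, h.length_eq]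
      · exact (hB v u w (h.length_eq ▸ hu) h.symm hw _ _ hk hj).symm
    · exact hB u v w hu h hw _ _ hj hk

/-- The equivalence of words over `P` generated by contraction and interchange. -/
def WordEquiv : List P → List P → Prop := Relation.EqvGen fun u v => Contract u v ∨ Swap u v

theorem WordEquiv.append {u v : List P} (h : WordEquiv u v) (p q : List P) :
    WordEquiv (p ++ u ++ q) (p ++ v ++ q) := by
  induction h with
  | rel u v h => exact .rel _ _ (h.imp (·.append p q) (·.append p q))
  | refl u => exact .refl _
  | symm u v _ ih => exact .symm _ _ ih
  | trans u v w _ _ ih ih' => exact .trans _ _ _ ih ih'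

theorem WordEquiv.of_contract {u v : List P} (h : Contract u v) : WordEquiv u v :=
  .rel _ _ (.inl h)

theorem WordEquiv.reducesToLength {u v : List P} (h : WordEquiv u v) :
    ∀ j k, ReducesToLength u j → ReducesToLength v k → j = k := by
  induction h with
  | rel u v h =>
    intro j k hj hk
    rcases h with h | h
    · exact (reducesToLength_unique _ u rfl).1 _ _ hj (.step _ _ _ h hk)
    · exact (reducesToLength_unique _ u rfl).2 v h _ _ hj hk
  | refl u => exact (reducesToLength_unique _ u rfl).1
  | symm u v _ ih => exact fun j k hj hk => (ih k j hk hj).symm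
  | trans u v w _ _ ih ih' =>
    intro j k hj hk
    obtain ⟨l, hl⟩ := exists_reducesToLength v
    exact (ih _ _ hj hl).trans (ih' _ _ hl hk)

/-- The word `ε w` over `P`. -/
def withEps (w : FreeMonoid (Letter P)) : List P := eps :: w.toList.map Subtype.val

theorem wordEquiv_insert_eps (p q : List P) (hp : p ≠ []) :
    WordEquiv (p ++ eps :: q) (p ++ q) := by
  obtain ⟨p, a, rfl⟩ := List.eq_nil_or_concat p |>.resolve_left hp
  have := (WordEquiv.of_contract (.head a eps a [] (mul_eps a))).append p q
  simpa using this

/-- The congruence on `Γ*` induced by `WordEquiv`. -/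
def wordCon (P : Type*) [Pregroup P] : Con (FreeMonoid (Letter P)) where
  r u v := WordEquiv (withEps u) (withEps v)
  iseqv := ⟨fun _ => .refl _, fun h => .symm _ _ h, fun h h' => .trans _ _ _ h h'⟩
  mul' := by
    intro u u' v v' hu hv
    -- Insert ε between `u'` and `v`, so that `v` can be replaced by `v'` behind its own ε.
    have h1 := hu.append [] (v.toList.map Subtype.val)
    have h2 := hv.append (withEps u') []
    have h3 := wordEquiv_insert_eps (withEps u') (v.toList.map Subtype.val) (by simp [withEps])
    have h4 := wordEquiv_insert_eps (withEps u') (v'.toList.map Subtype.val) (by simp [withEps])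
    simp only [withEps, List.nil_append, List.append_nil, FreeMonoid.toList_mul, List.map_append,
      List.cons_append] at h1 h2 h3 h4 ⊢
    exact h1.trans _ _ _ ((h3.symm _ _).trans _ _ _ (h2.trans _ _ _ h4))

theorem conGen_rule_le_wordCon : conGen (Rule P) ≤ wordCon P := by
  refine Con.conGen_le.2 fun u v h => ?_
  show WordEquiv (withEps u) (withEps v)
  cases h with
  | cancel a b h =>
    exact .trans _ _ _ (WordEquiv.of_contract (.cons eps [a.1, b.1] [eps] (.head _ _ _ _ h)))
      (WordEquiv.of_contract (.head _ _ _ _ (mul_eps eps)))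
  | contract a b x h => exact WordEquiv.of_contract (.cons eps [a.1, b.1] [x.1] (.head _ _ _ _ h))
  | interchange a b x y c hab hx hy =>
    exact .rel _ _ (.inr (.cons eps [a.1, b.1] [x.1, y.1] (.head _ _ _ _ _ _ hx hy)))

theorem wordEquiv_of_toU_eq {u v : List (Letter P)} (h : toU u = toU v) :
    WordEquiv (eps :: u.map Subtype.val) (eps :: v.map Subtype.val) :=
  conGen_rule_le_wordCon ((Con.eq _).1 h)

/-- Reduced words are geodesic. -/
theorem length_le_of_toU_eq {u v : List (Letter P)} (hu : Reduced (u.map Subtype.val))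
    (hl : 2 ≤ u.length) (h : toU u = toU v) : u.length ≤ v.length := by
  obtain ⟨a, u, rfl⟩ : ∃ a t, u = a :: t := List.exists_cons_of_length_pos (by omega)
  have h1 : ReducesToLength (eps :: (a :: u).map Subtype.val) (a :: u).length := by
    refine .step _ _ _ (.head _ _ _ _ (eps_mul a.1)) ?_
    simpa using ReducesToLength.refl _ hu
  obtain ⟨k, hk⟩ := exists_reducesToLength (v.map Subtype.val)
  cases v with
  | nil =>
    -- `[ε]` is itself reduced, of length 1; hence the bound 2 on `u.length`.
    have := (wordEquiv_of_toU_eq h).reducesToLength _ _ h1 (.refl [eps] (List.isChain_singleton _))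
    simp only [List.length_cons, List.length_nil] at this hl
    omega
  | cons b v =>
    have := (wordEquiv_of_toU_eq h).reducesToLength _ _ h1
      (.step _ _ _ (.head _ _ _ _ (eps_mul b.1)) hk)
    have hb := hk.bounds (by simp)
    simp only [List.length_map] at hb
    omega

/-! ### Words over `P` in the universal group -/

open Classical in
/-- The canonical map from the pregroup to its universal group. -/
noncomputable def ofP (a : P) : U P := if h : a = eps then 1 else toU [⟨a, h⟩]

theorem toU_append (u v : List (Letter P)) : toU (u ++ v) = toU u * toU v := rfl

theorem ofP_letter (a : Letter P) : ofP a.1 = toU [a] := dif_neg a.2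

theorem ofP_eps : ofP (eps : P) = 1 := dif_pos rfl

theorem ofP_mul {a b x : P} (h : mul a b = some x) : ofP x = ofP a * ofP b := by
  by_cases ha : a = eps
  · subst ha
    rw [eps_mul] at h
    cases h
    rw [ofP_eps, one_mul]
  by_cases hb : b = eps
  · subst hb
    rw [mul_eps] at h
    cases h
    rw [ofP_eps, mul_one]
  rw [ofP_letter ⟨a, ha⟩, ofP_letter ⟨b, hb⟩, ← toU_append]
  by_cases hx : x = eps
  · subst hx
    rw [ofP_eps]
    exact ((Con.eq _).2 (ConGen.Rel.of _ _ (Rule.cancel ⟨a, ha⟩ ⟨b, hb⟩ h))).symm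
  · rw [ofP_letter ⟨x, hx⟩]
    exact ((Con.eq _).2 (ConGen.Rel.of _ _ (Rule.contract ⟨a, ha⟩ ⟨b, hb⟩ ⟨x, hx⟩ h))).symm

theorem ofP_inv (a : P) : ofP (inv a) = (ofP a)⁻¹ := by
  rw [eq_inv_iff_mul_eq_one, ← ofP_mul (inv_mul a), ofP_eps]

/-- The element of the universal group represented by a word over `P`. -/
noncomputable def wordProd (w : List P) : U P := (w.map ofP).prod

@[simp] theorem wordProd_nil : wordProd ([] : List P) = 1 := rfl

@[simp] theorem wordProd_cons (a : P) (w : List P) :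
    wordProd (a :: w) = ofP a * wordProd w := List.prod_cons

@[simp] theorem wordProd_append (u v : List P) :
    wordProd (u ++ v) = wordProd u * wordProd v := by
  simp [wordProd]

theorem wordProd_map_val (w : List (Letter P)) : wordProd (w.map Subtype.val) = toU w := by
  induction w with
  | nil => rfl
  | cons a w ih =>
    rw [List.map_cons, wordProd_cons, ih, ofP_letter, ← toU_append]
    rfl

theorem Contract.wordProd_eq {u v : List P} (h : Contract u v) : wordProd u = wordProd v := by
  induction h with
  | head a b x q h => simp [ofP_mul h, _root_.mul_assoc]
  | cons p u v h ih => simp [ih]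

theorem exists_toU_eq_wordProd (u : List P) :
    ∃ w : List (Letter P), w.length ≤ u.length ∧ toU w = wordProd u := by
  induction u with
  | nil => exact ⟨[], le_rfl, rfl⟩
  | cons a u ih =>
    obtain ⟨w, hl, hw⟩ := ih
    by_cases ha : a = eps
    · exact ⟨w, by simp; omega, by simp [ha, ofP_eps, hw]⟩
    · refine ⟨⟨a, ha⟩ :: w, by simpa using hl, ?_⟩
      rw [wordProd_cons, ← hw, ofP_letter ⟨a, ha⟩, ← toU_append]
      rfl

/-- A letter ε has a defined product with any neighbour, and length 2 provides one. -/
theorem Reduced.ne_eps {u : List P} (hu : Reduced u) (hl : 2 ≤ u.length) : ∀ a ∈ u, a ≠ eps := by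
  rintro a ha rfl
  obtain ⟨p, q, rfl⟩ := List.append_of_mem ha
  obtain ⟨h1, h2⟩ := List.isChain_split.1 hu
  cases q with
  | cons b q => simp [eps_mul] at h2
  | nil =>
    obtain ⟨p, b, rfl⟩ := List.eq_nil_or_concat' p |>.resolve_left (by rintro rfl; simp at hl)
    simp [List.isChain_append, mul_eps] at h1

theorem length_le_of_wordProd_eq {u v : List P} (hu : Reduced u) (hl : 2 ≤ u.length)
    (h : wordProd u = wordProd v) : u.length ≤ v.length := by
  have he := hu.ne_eps hl
  lift u to List (Letter P) using he
  obtain ⟨w, hw, hwv⟩ := exists_toU_eq_wordProd v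
  rw [wordProd_map_val, ← hwv] at h
  have := length_le_of_toU_eq hu (by simpa using hl) h
  simp only [List.length_map]
  omega

/-- The formal inverse of a word. -/
def invWord (w : List P) : List P := (w.map inv).reverse

@[simp] theorem invWord_concat (w : List P) (a : P) :
    invWord (w ++ [a]) = inv a :: invWord w := by
  simp [invWord]

@[simp] theorem length_invWord (w : List P) : (invWord w).length = w.length := by
  simp [invWord]

@[simp] theorem wordProd_invWord (w : List P) : wordProd (invWord w) = (wordProd w)⁻¹ := by
  induction w with
  | nil => simp [invWord]
  | cons a w ih =>
    have : invWord (a :: w) = invWord w ++ [inv a] := by simp [invWord]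
    rw [this]
    simp [ih, ofP_inv]

theorem Reduced.invWord {w : List P} (h : Reduced w) : Reduced (invWord w) := by
  unfold Reduced Pregroup.invWord
  rw [List.isChain_reverse, List.isChain_map]
  exact List.IsChain.imp (fun a b hab => mul_inv_inv_eq_none hab) h

/-! ### Conjugation of cyclically reduced words -/

/-- `w` is of minimal length among the words representing conjugates of its value. -/
def ConjMinimal (w : List P) : Prop :=
  ∀ u : List P, IsConj (wordProd u) (wordProd w) → w.length ≤ u.length

theorem isConj_wordProd_of_isRotated {u v : List P} (h : u ~r v) :
    IsConj (wordProd u) (wordProd v) := by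
  obtain ⟨n, rfl⟩ := h
  rw [← List.rotate_mod, List.rotate_eq_drop_append_take_mod]
  conv_lhs => rw [← List.take_append_drop (n % u.length) u]
  simp only [Nat.mod_mod, wordProd_append]
  exact isConj_iff.2 ⟨(wordProd (u.take (n % u.length)))⁻¹, by group⟩

theorem ConjMinimal.isRotated {u v : List P} (hu : ConjMinimal u) (h : v ~r u) :
    ConjMinimal v := fun w hw =>
  h.perm.length_eq ▸ hu w (hw.trans (isConj_wordProd_of_isRotated h))

theorem ConjMinimal.reduced {u : List P} (hu : ConjMinimal u) : Reduced u := by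
  rcases reduced_or_exists_contract u with h | ⟨v, hv⟩
  · exact h
  · have := hu v (hv.wordProd_eq ▸ IsConj.refl _)
    have := hv.length_eq
    omega

theorem isRotated_cons_concat {α : Type*} (a : α) (w : List α) : (w ++ [a]) ~r (a :: w) :=
  (List.isRotated_append (l := [a]) (l' := w)).symm

/-- `h` conjugates some rotation `w` of the word `g` to the element `x`. -/
def ConjugatesTo (g : List P) (x : U P) (h w : List P) : Prop :=
  w ~r g ∧ x = wordProd h * wordProd w * (wordProd h)⁻¹

/-- With `d = ca`: `c(aw)c⁻¹ = d(wa)d⁻¹`. The conjugator keeps its length, hence its minimality. -/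
theorem ConjugatesTo.rotate_left {g : List P} {x : U P} {k w : List P} {c a d : P}
    (h : ConjugatesTo g x (k ++ [c]) (a :: w)) (hd : mul c a = some d) :
    ConjugatesTo g x (k ++ [d]) (w ++ [a]) := by
  refine ⟨(isRotated_cons_concat a w).trans h.1, h.2.trans ?_⟩
  simp only [wordProd_append, wordProd_cons, wordProd_nil, ofP_mul hd]
  group

theorem ConjugatesTo.rotate_right {g : List P} {x : U P} {k w : List P} {c a d : P}
    (h : ConjugatesTo g x (k ++ [c]) (w ++ [a])) (hd : mul a (inv c) = some d) :
    ConjugatesTo g x (k ++ [inv d]) (a :: w) := by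
  refine ⟨(isRotated_cons_concat a w).symm.trans h.1, h.2.trans ?_⟩
  simp only [wordProd_append, wordProd_cons, wordProd_nil, ofP_inv, ofP_mul hd]
  group

theorem Reduced.of_conjugatesTo_minimal {g : List P} {x : U P} {h w : List P}
    (hmin : ∀ h' w', ConjugatesTo g x h' w' → h.length ≤ h'.length)
    (hc : ConjugatesTo g x h w) : Reduced h := by
  rcases reduced_or_exists_contract h with hr | ⟨v, hv⟩
  · exact hr
  · have := hmin v w ⟨hc.1, hv.wordProd_eq ▸ hc.2⟩
    have := hv.length_eq
    omega

theorem Reduced.append_of_cons {u v : List P} {a : P} (hu : Reduced (u ++ [a]))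
    (hv : Reduced (a :: v)) : Reduced (u ++ a :: v) := List.isChain_split.2 ⟨hu, hv⟩

theorem Reduced.append_two {u v : List P} {a b : P} (hu : Reduced (u ++ [a]))
    (hv : Reduced (b :: v)) (hab : mul a b = none) : Reduced (u ++ a :: b :: v) :=
  hu.append_of_cons (List.isChain_cons_cons.2 ⟨hab, hv⟩)

theorem Reduced.left {u v : List P} (h : Reduced (u ++ v)) : Reduced u :=
  List.IsChain.left_of_append h

theorem Reduced.right {u v : List P} (h : Reduced (u ++ v)) : Reduced v :=
  List.IsChain.right_of_append h

theorem Reduced.mul_eq_none {u v : List P} {a b : P} (h : Reduced (u ++ a :: b :: v)) :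
    mul a b = none := by
  have := h.right
  exact (List.isChain_cons_cons.1 this).1

/-- After at most two rotations of a cyclically reduced word, the last letter of the conjugator is
not absorbed any more. -/
theorem exists_conjugatesTo_mul_eq_none {g : List P} (hg : ConjMinimal g) (hn : 2 ≤ g.length)
    {x : U P} {k w : List P} {c : P} (h : ConjugatesTo g x (k ++ [c]) w) :
    ∃ c' a w', ConjugatesTo g x (k ++ [c']) (a :: w') ∧ mul c' a = none := by
  have hl := h.1.perm.length_eq
  obtain ⟨a, b, t, rfl⟩ : ∃ a b t, w = a :: b :: t := by
    rcases w with _ | ⟨a, _ | ⟨b, t⟩⟩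
    · simp at hl; omega
    · simp at hl; omega
    · exact ⟨a, b, t, rfl⟩
  cases hca : mul c a with
  | none => exact ⟨c, a, _, h, hca⟩
  | some y =>
    have h1 := h.rotate_left hca
    cases hyb : mul y b with
    | none => exact ⟨y, b, _, h1, hyb⟩
    | some z =>
      have h2 := h1.rotate_left hyb
      have r0 : Reduced (a :: b :: t) := (hg.isRotated h.1).reduced
      have r1 : Reduced (b :: (t ++ [a])) := (hg.isRotated h1.1).reduced
      have hab : mul a b = none := r0.mul_eq_none (u := [])
      -- For words of length 2 the third letter met is `a` again.
      cases t with
      | nil => exact ⟨z, a, _, h2, mul_eq_none_of_absorb_right hab (r1.mul_eq_none (u := [])) hca hyb⟩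
      | cons d t =>
        exact ⟨z, d, _, h2, mul_eq_none_of_absorb_right hab (r1.mul_eq_none (u := [])) hca hyb⟩

/-- A shortest conjugator between cyclically reduced words, up to rotations, has length at most
one. -/
theorem length_le_one_of_minimal {g f : List P} (hg : ConjMinimal g) (hn : 2 ≤ g.length)
    (hf : f.length ≤ g.length) {h w : List P}
    (hmin : ∀ h' w', ConjugatesTo g (wordProd f) h' w' → h.length ≤ h'.length)
    (hc : ConjugatesTo g (wordProd f) h w) : h.length ≤ 1 := by
  by_contra! hl
  obtain ⟨k, c₀, rfl⟩ := List.eq_nil_or_concat' h |>.resolve_left (by rintro rfl; simp at hl)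
  have hmin' : ∀ e : P, ∀ h' w', ConjugatesTo g (wordProd f) h' w' →
      (k ++ [e]).length ≤ h'.length := fun e => by simpa using hmin
  obtain ⟨c, a, t, hc, hca⟩ := exists_conjugatesTo_mul_eq_none hg hn hc
  have hk : Reduced (k ++ [c]) := .of_conjugatesTo_minimal (hmin' c) hc
  have hr : Reduced (k ++ c :: a :: t) := hk.append_two (hg.isRotated hc.1).reduced hca
  have hlen := hc.1.perm.length_eq
  generalize a :: t = w at hc hr hlen
  obtain ⟨w, r, rfl⟩ := List.eq_nil_or_concat' w |>.resolve_left
    (by rintro rfl; simp at hlen; omega)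
  obtain ⟨w, q, rfl⟩ := List.eq_nil_or_concat' w |>.resolve_left
    (by rintro rfl; simp at hlen; omega)
  -- `p` precedes `q`; it is `c` itself when `g` has only two letters.
  obtain ⟨s, p, hs⟩ := List.eq_nil_or_concat' (c :: w) |>.resolve_left (by simp)
  have hls := congrArg List.length hs
  have hprod := congrArg wordProd hs
  have hr' : Reduced (k ++ s ++ [p, q, r]) := by
    have : k ++ s ++ [p, q, r] = k ++ c :: (w ++ [q] ++ [r]) := by
      have := congrArg (fun l => k ++ l ++ [q, r]) hs
      simpa using this.symm
    rwa [this]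
  have hval : wordProd f = wordProd (k ++ s ++ [p, q, r] ++ inv c :: invWord k) := by
    rw [hc.2]
    simp only [wordProd_append, wordProd_cons, wordProd_nil, ofP_inv, wordProd_invWord,
      mul_one] at hprod ⊢
    simp only [mul_inv_rev, ← _root_.mul_assoc] at hprod ⊢
    rw [_root_.mul_assoc (wordProd k) (wordProd s), ← hprod]
    simp only [_root_.mul_assoc]
  simp only [List.length_append, List.length_cons, List.length_nil] at hl hlen hls
  have key : ∀ u, Reduced u → wordProd f = wordProd u → ¬ g.length < u.length := by
    intro u hu h hlt
    have := length_le_of_wordProd_eq hu (by omega) h.symm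
    omega
  -- According as 0, 1 or 2 letters on the right absorb, the reduced word has length `2|h| + n`
  -- minus that number.
  cases hrc : mul r (inv c) with
  | none =>
    refine key (k ++ s ++ [p, q] ++ r :: inv c :: invWord k) ?_ (by simpa using hval)
      (by simp; omega)
    refine Reduced.append_two (by simpa using hr') ?_ hrc
    simpa using hk.invWord
  | some y =>
    have hc1 := hc.rotate_right hrc
    -- The rotated conjugator is again shortest, so the tail `y k̄` is reduced.
    have hk1 := (Reduced.of_conjugatesTo_minimal (hmin' _) hc1).invWord
    rw [invWord_concat, inv_inv] at hk1
    have hval1 : wordProd f = wordProd (k ++ s ++ [p] ++ q :: y :: invWord k) := by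
      rw [hval]
      simp [ofP_mul hrc, _root_.mul_assoc]
    cases hqy : mul q y with
    | none =>
      refine key _ (Reduced.append_two ?_ hk1 hqy) hval1 (by simp; omega)
      have : k ++ s ++ [p] ++ [q] ++ [r] = k ++ s ++ [p, q, r] := by simp
      exact Reduced.left (this ▸ hr')
    | some z =>
      have hc2 := hc1.rotate_right (w := r :: w) (by rwa [inv_inv])
      have hk2 := (Reduced.of_conjugatesTo_minimal (hmin' _) hc2).invWord
      rw [invWord_concat, inv_inv] at hk2
      have hpq : mul p q = none := hr'.mul_eq_none
      have hqr : mul q r = none := by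
        refine Reduced.mul_eq_none (u := k ++ s ++ [p]) (v := []) ?_
        simpa using hr'
      refine key (k ++ s ++ p :: z :: invWord k) (Reduced.append_two ?_ hk2
        (mul_eq_none_of_absorb_left hpq hqr hrc hqy)) ?_ (by simp; omega)
      · have : k ++ s ++ [p] ++ [q, r] = k ++ s ++ [p, q, r] := by simp
        exact Reduced.left (this ▸ hr')
      · rw [hval1]
        simp [ofP_mul hqy, _root_.mul_assoc]

/-- A conjugator of length at most one can be chosen to be absorbed on both sides. -/
theorem exists_preconjugation_of_conjugatesTo {g f : List P} (hg : ConjMinimal g)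
    (hn : 2 ≤ g.length) (hf : f.length ≤ g.length) {b : P} {w : List P}
    (hc : ConjugatesTo g (wordProd f) [b] w) :
    ∃ b a z x y m, (a :: (m ++ [z])) ~r g ∧ mul b a = some x ∧ mul z (inv b) = some y ∧
      wordProd f = wordProd (x :: (m ++ [y])) := by
  have main : ∀ b a z x y m, ConjugatesTo g (wordProd f) [b] (a :: (m ++ [z])) →
      mul b a = some x → mul z (inv b) = some y →
      ∃ b a z x y m, (a :: (m ++ [z])) ~r g ∧ mul b a = some x ∧ mul z (inv b) = some y ∧
        wordProd f = wordProd (x :: (m ++ [y])) := by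
    refine fun b a z x y m hc hx hy => ⟨b, a, z, x, y, m, hc.1, hx, hy, hc.2.trans ?_⟩
    simp [ofP_mul hx, ofP_mul hy, ofP_inv, _root_.mul_assoc]
  have key : ∀ u, Reduced u → wordProd f = wordProd u → ¬ g.length < u.length := by
    intro u hu h hlt
    have := length_le_of_wordProd_eq hu (by omega) h.symm
    omega
  have hlen := hc.1.perm.length_eq
  have hr := (hg.isRotated hc.1).reduced
  obtain ⟨a, w, rfl⟩ : ∃ a t, w = a :: t := List.exists_cons_of_length_pos (by omega)
  obtain ⟨m, z, rfl⟩ := List.eq_nil_or_concat' w |>.resolve_left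
    (by rintro rfl; simp at hlen; omega)
  simp only [List.length_append, List.length_cons, List.length_nil] at hlen
  have hval := hc.2
  cases hx : mul b a with
  | some x =>
    cases hy : mul z (inv b) with
    | some y => exact main _ _ _ _ _ _ hc hx hy
    | none =>
      -- After rotation the conjugator is `x = [ba]`, absorbed on the right since `a x̄ = b̄`.
      have hc1 := ConjugatesTo.rotate_left (k := []) hc hx
      obtain ⟨d, t, ht⟩ : ∃ d t, m ++ [z] = d :: t :=
        List.exists_cons_of_length_pos (by simp)
      rw [ht] at hc1
      cases hxd : mul x d with
      | some e =>
        refine main x d a e (inv b) t hc1 hxd ?_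
        exact mul_inv_mul_cancel_left (mul_rev _ _ _ hx)
      | none =>
        refine absurd ?_ (key (x :: (m ++ z :: [inv b])) ?_ ?_)
        · simp; omega
        · have h1 : Reduced ((x :: m) ++ [z]) := by
            rw [List.cons_append, ht]
            exact List.isChain_cons_cons.2 ⟨hxd, ht ▸ Reduced.right (u := [a]) hr⟩
          exact h1.append_two (List.isChain_singleton _) hy
        · rw [hval]
          simp [ofP_mul hx, ofP_inv, _root_.mul_assoc]
  | none =>
    cases hy : mul z (inv b) with
    | none =>
      refine absurd ?_ (key (b :: a :: (m ++ z :: [inv b])) ?_ ?_)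
      · simp; omega
      · have h1 : Reduced ((b :: a :: m) ++ [z]) := List.isChain_cons_cons.2 ⟨hx, hr⟩
        exact h1.append_two (List.isChain_singleton _) hy
      · rw [hval]
        simp [ofP_inv, _root_.mul_assoc]
    | some y =>
      have hc1 := ConjugatesTo.rotate_right (k := []) (w := a :: m) hc hy
      obtain ⟨t, d, ht⟩ := List.eq_nil_or_concat' (a :: m) |>.resolve_left (by simp)
      rw [ht] at hc1
      cases hdy : mul d y with
      | some e =>
        refine main (inv y) z d b e t hc1 ?_ (by rwa [inv_inv])
        have h := mul_inv_cancel_right (mul_rev _ _ _ hy)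
        rwa [inv_inv, inv_inv] at h
      | none =>
        refine absurd ?_ (key (b :: a :: (m ++ [y])) ?_ ?_)
        · simp; omega
        · have h0 : Reduced (b :: a :: m) := by
            refine List.isChain_cons_cons.2 ⟨hx, ?_⟩
            exact Reduced.left (u := a :: m) (v := [z]) hr
          have h1 : Reduced ((b :: t) ++ d :: [y]) := by
            refine Reduced.append_two ?_ (List.isChain_singleton _) hdy
            rwa [List.cons_append, ← ht]
          have e : b :: a :: (m ++ [y]) = (b :: t) ++ d :: [y] := by
            have := congrArg (fun l => b :: (l ++ [y])) ht
            simpa using this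
          rwa [e]
        · rw [hval]
          simp [ofP_mul hy, ofP_inv, _root_.mul_assoc]

/-- Conjugate cyclically reduced words agree up to one rotation and one preconjugation. -/
theorem exists_preconjugation {g f : List P} (hg : ConjMinimal g) (hn : 2 ≤ g.length)
    (hf : f.length ≤ g.length) (hc : IsConj (wordProd g) (wordProd f)) :
    ∃ b a z x y m, (a :: (m ++ [z])) ~r g ∧ mul b a = some x ∧ mul z (inv b) = some y ∧
      wordProd f = wordProd (x :: (m ++ [y])) := by
  classical
  have hex : ∃ n h w, ConjugatesTo g (wordProd f) h w ∧ h.length = n := by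
    obtain ⟨c, hc⟩ := isConj_iff.1 hc
    obtain ⟨c, rfl⟩ : ∃ u : List (Letter P), toU u = c := by
      induction c using Con.induction_on with
      | H w => exact ⟨w.toList, rfl⟩
    refine ⟨_, c.map Subtype.val, g, ⟨.refl g, ?_⟩, rfl⟩
    rw [wordProd_map_val, hc]
  obtain ⟨h, w, hcon, hl⟩ := Nat.find_spec hex
  have hmin : ∀ h' w', ConjugatesTo g (wordProd f) h' w' → h.length ≤ h'.length :=
    fun h' w' hc' => hl ▸ Nat.find_min' hex ⟨h', w', hc', rfl⟩
  have h1 := length_le_one_of_minimal hg hn hf hmin hcon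
  obtain _ | ⟨b, _ | ⟨b', h⟩⟩ := h
  -- The empty conjugator counts as the letter ε.
  · refine exists_preconjugation_of_conjugatesTo hg hn hf (b := eps) ⟨hcon.1, ?_⟩
    simpa [ofP_eps] using hcon.2
  · exact exists_preconjugation_of_conjugatesTo hg hn hf hcon
  · simp at h1

theorem CyclicallyReduced.conjMinimal {g : List (Letter P)} (hg : CyclicallyReduced g) :
    ConjMinimal (g.map Subtype.val) := by
  intro u hu
  obtain ⟨w, hw, hwu⟩ := exists_toU_eq_wordProd u
  rw [← hwu, wordProd_map_val] at hu
  rw [List.length_map]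
  exact (hg w hu).trans hw

end Pregroup

theorem mainTheorem2 {P : Type*} [Pregroup P] (g f : List (Pregroup.Letter P))
    (hg : Pregroup.CyclicallyReduced g) (hf : Pregroup.CyclicallyReduced f)
    (hn : 2 ≤ g.length) (hconj : IsConj (Pregroup.toU g) (Pregroup.toU f)) :
    ∃ (i : ℕ) (b : P) (v : List (Pregroup.Letter P)), i < g.length ∧
      Pregroup.IsPreconjugation b (g.rotate i) v ∧ Pregroup.toU f = Pregroup.toU v := by
  have hG := hg.conjMinimal
  obtain ⟨b, a, z, x, y, m, hrot, hx, hy, hv⟩ := Pregroup.exists_preconjugation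
    (f := f.map Subtype.val) hG (by simpa using hn)
    (by simpa using hf g hconj) (by simpa only [Pregroup.wordProd_map_val] using hconj)
  have hlen := hrot.perm.length_eq
  simp only [List.length_append, List.length_cons, List.length_nil] at hlen
  -- If `x` or `y` were ε, dropping it would give a conjugate of `g` shorter than `g`.
  have hshort : ∀ u, Pregroup.wordProd (x :: (m ++ [y])) = Pregroup.wordProd u →
      (g.map Subtype.val).length ≤ u.length := by
    intro u hu
    refine hG u ?_
    rw [← hu, ← hv, Pregroup.wordProd_map_val, Pregroup.wordProd_map_val]
    exact hconj.symm
  have hxe : x ≠ Pregroup.eps := by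
    rintro rfl
    have := hshort (m ++ [y]) (by simp [Pregroup.ofP_eps])
    simp only [List.length_append, List.length_cons, List.length_nil] at this
    omega
  have hye : y ≠ Pregroup.eps := by
    rintro rfl
    have := hshort (x :: m) (by simp [Pregroup.ofP_eps])
    simp only [List.length_cons] at this
    omega
  obtain ⟨i, hi⟩ := hrot.symm
  rw [← List.map_rotate] at hi
  obtain ⟨a, t, hat, rfl, ht⟩ := List.map_eq_cons_iff.1 hi
  obtain ⟨m, t', rfl, rfl, ht'⟩ := List.map_eq_append_iff.1 ht
  obtain ⟨z, rfl, rfl⟩ := List.map_eq_singleton_iff.1 ht'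
  refine ⟨i % g.length, b, ⟨x, hxe⟩ :: (m ++ [⟨y, hye⟩]), Nat.mod_lt _ (by omega), ?_, ?_⟩
  · rw [List.rotate_mod]
    exact ⟨a, z, ⟨x, hxe⟩, ⟨y, hye⟩, m, hat, hx, hy, rfl⟩
  · rw [← Pregroup.wordProd_map_val, hv, ← Pregroup.wordProd_map_val]
    simp
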